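/- Let $n$ be a natural number and $[n]=\{1,\dots,n\}$. A set system $\mathcal F\subseteq 2^{[n]}$ \emph{shatters} $S\subseteq[n]$ if $\{F\cap S: F\in\mathcal F\}=2^S$; it is \emph{shattering-extremal} if it shatters exactly $|\mathcal F|$ sets; its VC-dimension $\dim_{VC}(\mathcal F)$ is the maximum size of a set that it shatters. $\mathcal F$ \emph{strongly shatters} $S\subseteq[n]$ if there is $I\subseteq[n]\setminus S$ such that $H\cup I\in\mathcal F$ for all $H\subseteq S$. Write $\mathrm{supp}(\mathcal F)=\bigcup_{F\in\mathcal F}F$. Consider the following two operations on a set system $\mathcal F\subseteq 2^{[n]}$. Step A: choose $\alpha\in[n]\setminus\mathrm{supp}(\mathcal F)$ and $W\in\mathcal F$, and add the set $W\cup\{\alpha\}$ to $\mathcal F$. Step B: choose distinct $\alpha,\beta\in\mathrm{supp}(\mathcal F)$ such that $\{\alpha,\beta\}$ is not strongly shattered by $\mathcal F$, and sets $P,W,Q\in\mathcal F$ with $Q\bigtriangleup W=\{\alpha\}$ and $P\bigtriangleup W=\{\beta\}$, and add the set $W\bigtriangleup\{\alpha,\beta\}$ to $\mathcal F$. Let $\mathcal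 E$ be the collection of all set systems that can be obtained from $\{\emptyset\}$ by a finite (possibly empty) sequence of Steps A and B, each valid when it is applied. Theorem. A set system $\mathcal F\subseteq 2^{[n]}$ is shattering-extremal with $\dim_{VC}(\mathcal F)\le 2$ and $\emptyset\in\mathcal F$ if and only if $\mathcal F\in\mathcal E$. -/

import Mathlib

namespace ShatteringExtremal

variable {α : Type*} [DecidableEq α]

/-- The support of a set system: the union of its members. -/
def supp (F : Finset (Finset α)) : Finset α := F.biUnion id

/-- A set system is shattering-extremal if it shatters exactly `|F|` sets. -/
def IsExtremal (F : Finset (Finset α)) : Prop := F.shatterer.card = F.card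

/-- `F` strongly shatters `S` if, for some `I` disjoint from `S`, every `H ∪ I` with `H ⊆ S`
belongs to `F`. -/
def StronglyShatters (F : Finset (Finset α)) (S : Finset α) : Prop :=
  ∃ I : Finset α, Disjoint I S ∧ ∀ H : Finset α, H ⊆ S → H ∪ I ∈ F

/-- Step A turns `F` into `F'`: choose an element `a` outside the support of `F` and a member `W`
of `F`, and add `W ∪ {a}`. -/
def StepA (F F' : Finset (Finset α)) : Prop :=
  ∃ a : α, a ∉ supp F ∧ ∃ W ∈ F, F' = insert (W ∪ {a}) F

/-- Step B turns `F` into `F'`: choose two elements `a`, `b` of the support of `F` such that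
`{a, b}` is not strongly shattered by `F`, and members `P`, `W`, `Q` of `F` with `Q ∆ W = {a}` and
`P ∆ W = {b}`, and add `W ∆ {a, b}`. -/
def StepB (F F' : Finset (Finset α)) : Prop :=
  ∃ a ∈ supp F, ∃ b ∈ supp F, a ≠ b ∧ ¬ StronglyShatters F {a, b} ∧
    ∃ P ∈ F, ∃ W ∈ F, ∃ Q ∈ F, symmDiff Q W = {a} ∧ symmDiff P W = {b} ∧
      F' = insert (symmDiff W {a, b}) F

/-- The class of all set systems that can be built up from `{∅}` by finitely many Steps A and B,
in any valid order. -/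
inductive IsConstructible : Finset (Finset α) → Prop
  | init : IsConstructible {∅}
  | stepA {F F' : Finset (Finset α)} : IsConstructible F → StepA F F' → IsConstructible F'
  | stepB {F F' : Finset (Finset α)} : IsConstructible F → StepB F F' → IsConstructible F'

end ShatteringExtremal

namespace ShatteringExtremal

variable {α : Type*} [DecidableEq α]

/-! Every family shatters at least as many sets as it has members, so adding one set preserves
extremality as soon as it creates at most one newly shattered set. Step A can only create `{a}` and
Step B only `{a, b}`, which gives one direction. Conversely, let `G` be a largest constructible
subfamily of an extremal `F`; by the first direction `G` is extremal. Extremal families are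
isometric in the cube graph, and so are their subcubes of a fixed direction set
(`IsExtremal.exists_adjacent_cube`). If `G ≠ F`, some edge of `F` leaves `G`. If its direction is
new to `G`, Step A applies. Otherwise that edge is moved towards a parallel edge of `G` until three
corners of a square lie in `G` and the fourth does not (`exists_stepB`). VC-dimension at most two
makes the square with given directions unique, so Step B is valid. Either way the maximality of `G`
is contradicted. -/

lemma symmDiff_empty (X : Finset α) : symmDiff X ∅ = X := symmDiff_bot X

/-! ### Splitting a family along one element -/

lemma notMem_of_shatters_of_forall_mem {F : Finset (Finset α)} {S : Finset α} {a : α}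
    (hF : ∀ X ∈ F, a ∈ X) (hS : F.Shatters S) : a ∉ S := by
  intro ha
  obtain ⟨u, hu, h⟩ := hS (Finset.empty_subset S)
  have : a ∈ S ∩ u := Finset.mem_inter.2 ⟨ha, hF u hu⟩
  simp [h] at this

lemma notMem_of_shatters_of_forall_notMem {F : Finset (Finset α)} {S : Finset α} {a : α}
    (hF : ∀ X ∈ F, a ∉ X) (hS : F.Shatters S) : a ∉ S := by
  intro ha
  obtain ⟨u, hu, h⟩ := hS (Finset.Subset.refl S)
  exact hF u hu (Finset.inter_eq_left.1 h ha)

lemma Shatters.insert_of_halves {F : Finset (Finset α)} {S : Finset α} {a : α}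
    (h₁ : (F.filter (a ∈ ·)).Shatters S) (h₀ : (F.filter (a ∉ ·)).Shatters S) :
    F.Shatters (insert a S) := by
  have haS : a ∉ S :=
    notMem_of_shatters_of_forall_mem (fun X hX => (Finset.mem_filter.1 hX).2) h₁
  intro t ht
  have hts : t.erase a ⊆ S := by
    intro x hx
    have := ht (Finset.mem_of_mem_erase hx)
    exact (Finset.mem_insert.1 this).resolve_left (Finset.ne_of_mem_erase hx)
  by_cases hat : a ∈ t
  · obtain ⟨u, hu, h⟩ := h₁ hts
    rw [Finset.mem_filter] at hu
    refine ⟨u, hu.1, ?_⟩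
    rw [Finset.insert_inter_of_mem hu.2, h, Finset.insert_erase hat]
  · obtain ⟨u, hu, h⟩ := h₀ hts
    rw [Finset.mem_filter] at hu
    refine ⟨u, hu.1, ?_⟩
    rw [Finset.insert_inter_of_notMem hu.2, h, Finset.erase_eq_of_notMem hat]

lemma shatterer_halves_le (F : Finset (Finset α)) (a : α) :
    (F.filter (a ∈ ·)).shatterer ∪ (F.filter (a ∉ ·)).shatterer ⊆ F.shatterer.filter (a ∉ ·) ∧
    ((F.filter (a ∈ ·)).shatterer ∩ (F.filter (a ∉ ·)).shatterer).card ≤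
      (F.shatterer.filter (a ∈ ·)).card := by
  constructor
  · intro S hS
    rw [Finset.mem_union, Finset.mem_shatterer, Finset.mem_shatterer] at hS
    rw [Finset.mem_filter, Finset.mem_shatterer]
    rcases hS with hS | hS
    · exact ⟨hS.mono_left (Finset.filter_subset _ _),
        notMem_of_shatters_of_forall_mem (fun X hX => (Finset.mem_filter.1 hX).2) hS⟩
    · exact ⟨hS.mono_left (Finset.filter_subset _ _),
        notMem_of_shatters_of_forall_notMem (fun X hX => (Finset.mem_filter.1 hX).2) hS⟩
  · refine Finset.card_le_card_of_injOn (insert a) ?_ ?_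
    · intro S hS
      rw [Finset.mem_coe, Finset.mem_inter, Finset.mem_shatterer, Finset.mem_shatterer] at hS
      rw [Finset.mem_coe, Finset.mem_filter, Finset.mem_shatterer]
      exact ⟨Shatters.insert_of_halves hS.1 hS.2, Finset.mem_insert_self _ _⟩
    · have key : ∀ S ∈ (F.filter (a ∈ ·)).shatterer ∩ (F.filter (a ∉ ·)).shatterer, a ∉ S := by
        intro S hS
        rw [Finset.mem_inter, Finset.mem_shatterer] at hS
        exact notMem_of_shatters_of_forall_mem (fun X hX => (Finset.mem_filter.1 hX).2) hS.1
      intro S hS T hT h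
      have h' := congrArg (Finset.erase · a) h
      simpa [Finset.erase_insert (key S hS), Finset.erase_insert (key T hT)] using h'

/-- The halves shatter at least `|F|` sets in total, counted with multiplicity, while
`shatterer_halves_le` bounds this total by the number of sets shattered by `F`, which is `|F|`.
Hence all the inequalities are equalities. -/
lemma IsExtremal.halves {F : Finset (Finset α)} (hF : IsExtremal F) (a : α) :
    IsExtremal (F.filter (a ∈ ·)) ∧ IsExtremal (F.filter (a ∉ ·)) ∧
      ∀ S, F.Shatters S → a ∉ S →
        (F.filter (a ∈ ·)).Shatters S ∨ (F.filter (a ∉ ·)).Shatters S := by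
  unfold IsExtremal at *
  obtain ⟨h₁, h₂⟩ := shatterer_halves_le F a
  have h₃ := Finset.card_le_card h₁
  have h₄ := Finset.card_union_add_card_inter (F.filter (a ∈ ·)).shatterer
    (F.filter (a ∉ ·)).shatterer
  have h₅ := Finset.card_filter_add_card_filter_not (s := F) (a ∈ ·)
  have h₆ := Finset.card_filter_add_card_filter_not (s := F.shatterer) (a ∈ ·)
  have h₇ := Finset.card_le_card_shatterer (F.filter (a ∈ ·))
  have h₈ := Finset.card_le_card_shatterer (F.filter (a ∉ ·))
  refine ⟨by omega, by omega, fun S hS haS => ?_⟩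
  have h₉ := Finset.eq_of_subset_of_card_le h₁ (by omega)
  have : S ∈ F.shatterer.filter (a ∉ ·) :=
    Finset.mem_filter.2 ⟨Finset.mem_shatterer.2 hS, haS⟩
  rw [← h₉, Finset.mem_union, Finset.mem_shatterer, Finset.mem_shatterer] at this
  exact this

/-! ### Cubes inside extremal families and isometry -/

/-- The restriction of an extremal family to a subcube is extremal. -/
lemma IsExtremal.filter_agree {F : Finset (Finset α)} (hF : IsExtremal F) (X D : Finset α) :
    IsExtremal (F.filter fun Z => ∀ d ∈ D, d ∈ Z ↔ d ∈ X) := by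
  induction D using Finset.induction_on with
  | empty => simpa using hF
  | insert d D _ ih =>
    have h := ih.halves d
    rw [Finset.filter_filter, Finset.filter_filter] at h
    by_cases hd : d ∈ X
    · convert h.1 using 3 with Z
      simp [hd, and_comm]
    · convert h.2.1 using 3 with Z
      simp [hd, and_comm]

/-- In an extremal family every shattered set spans a whole cube of the family. -/
lemma IsExtremal.exists_cube {F : Finset (Finset α)} (hF : IsExtremal F) {S : Finset α}
    (hS : F.Shatters S) : ∃ X, ∀ H ⊆ S, symmDiff X H ∈ F := by
  induction hn : F.card using Nat.strong_induction_on generalizing F with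
  | _ n ih =>
  subst hn
  by_cases hc : ∃ a, a ∉ S ∧ (∃ X ∈ F, a ∈ X) ∧ ∃ Y ∈ F, a ∉ Y
  · obtain ⟨a, haS, ⟨X, hX, haX⟩, Y, hY, haY⟩ := hc
    obtain ⟨h₁, h₀, h⟩ := hF.halves a
    rcases h S hS haS with h | h
    · obtain ⟨Z, hZ⟩ := ih _ (Finset.card_lt_card
        (Finset.filter_ssubset.2 ⟨Y, hY, haY⟩)) h₁ h rfl
      exact ⟨Z, fun H hH => (Finset.mem_filter.1 (hZ H hH)).1⟩
    · obtain ⟨Z, hZ⟩ := ih _ (Finset.card_lt_card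
        (Finset.filter_ssubset.2 ⟨X, hX, not_not.2 haX⟩)) h₀ h rfl
      exact ⟨Z, fun H hH => (Finset.mem_filter.1 (hZ H hH)).1⟩
  -- Now all members of `F` agree outside `S`, so a member is determined by its trace on `S`.
  · push Not at hc
    obtain ⟨X, hX, -⟩ := hS (Finset.empty_subset S)
    refine ⟨X, fun H hH => ?_⟩
    have hsub : S ∩ symmDiff X H ⊆ S := Finset.inter_subset_left
    obtain ⟨u, hu, h⟩ := hS hsub
    convert hu using 1
    ext x
    by_cases hx : x ∈ S
    · have := Finset.ext_iff.1 h x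
      simp only [Finset.mem_inter, hx, true_and] at this
      exact this.symm
    · have h₁ := hc x hx
      have : x ∉ H := fun h => hx (hH h)
      simp only [Finset.mem_symmDiff, this]
      constructor
      · rintro (h | h)
        · exact h₁ ⟨X, hX, h.1⟩ u hu
        · exact h.1.elim
      · intro h
        exact Or.inl ⟨h₁ ⟨u, hu, h⟩ X hX, id⟩

lemma IsExtremal.stronglyShatters {F : Finset (Finset α)} (hF : IsExtremal F) {S : Finset α}
    (hS : F.Shatters S) : StronglyShatters F S := by
  obtain ⟨X, hX⟩ := hF.exists_cube hS
  refine ⟨X \ S, Finset.sdiff_disjoint, fun H hH => ?_⟩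
  convert hX (symmDiff (X ∩ S) H) ?_ using 1
  · ext x
    have := @hH x
    simp only [Finset.mem_symmDiff, Finset.mem_union, Finset.mem_inter, Finset.mem_sdiff]
    tauto
  · intro x hx
    have := @hH x
    simp only [Finset.mem_symmDiff, Finset.mem_inter] at hx
    tauto

/-- If an extremal family contains the `T`-cubes at `X` and at `Y`, then for each `c` separating
`X` from `Y` it contains a `T ∪ {c}`-cube between them. -/
lemma IsExtremal.exists_cube_between {F : Finset (Finset α)} (hF : IsExtremal F)
    {X Y T : Finset α} {c : α} (hT : Disjoint T (symmDiff X Y))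
    (hX : ∀ H ⊆ T, symmDiff X H ∈ F) (hY : ∀ H ⊆ T, symmDiff Y H ∈ F)
    (hc : c ∈ symmDiff X Y) :
    ∃ Z, symmDiff X Z ⊆ (symmDiff X Y).erase c ∧ ∀ H ⊆ insert c T, symmDiff Z H ∈ F := by
  have hT' : ∀ x ∈ T, x ∉ symmDiff X Y := fun x h h' => Finset.disjoint_left.1 hT h h'
  have hcT : c ∉ T := fun h => hT' c h hc
  -- Fixing the coordinates in `D` as in `X` confines the family to the subcube spanned by `T` and
  -- `symmDiff X Y`. The union with `X` replaces the ground set, as `α` may be infinite.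
  set D : Finset α := (F.biUnion id ∪ X) \ (T ∪ symmDiff X Y) with hD
  have hE := hF.filter_agree X D
  have hmemX : ∀ H ⊆ T, symmDiff X H ∈ F.filter fun Z => ∀ d ∈ D, d ∈ Z ↔ d ∈ X := by
    intro H hH
    refine Finset.mem_filter.2 ⟨hX H hH, fun d hd => ?_⟩
    have : d ∉ H := fun h => by simp [hD, hH h] at hd
    simp [Finset.mem_symmDiff, this]
  have hmemY : ∀ H ⊆ T, symmDiff Y H ∈ F.filter fun Z => ∀ d ∈ D, d ∈ Z ↔ d ∈ X := by
    intro H hH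
    refine Finset.mem_filter.2 ⟨hY H hH, fun d hd => ?_⟩
    have h₁ : d ∉ H := fun h => by simp [hD, hH h] at hd
    have h₂ : d ∉ symmDiff X Y := fun h => (Finset.mem_sdiff.1 hd).2 (Finset.mem_union_right _ h)
    simp only [Finset.mem_symmDiff] at h₂ ⊢
    tauto
  -- The two `T`-cubes lie on opposite sides of `c`: the value at `c` selects the cube, and `V` is
  -- then altered on `T` to match `t`.
  have hS : (F.filter fun Z => ∀ d ∈ D, d ∈ Z ↔ d ∈ X).Shatters (insert c T) := by
    intro t ht
    have aux : ∀ V : Finset α, (c ∈ V ↔ c ∈ t) →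
        insert c T ∩ symmDiff V (symmDiff V t ∩ T) = t := by
      intro V hV
      ext x
      have := @ht x
      by_cases hxc : x = c
      · subst hxc
        simp only [Finset.mem_symmDiff, Finset.mem_inter, Finset.mem_insert, true_or]
        tauto
      · simp only [Finset.mem_symmDiff, Finset.mem_inter, Finset.mem_insert, hxc, false_or] at this ⊢
        tauto
    by_cases h : c ∈ X ↔ c ∈ t
    · exact ⟨_, hmemX _ Finset.inter_subset_right, aux X h⟩
    · refine ⟨_, hmemY _ Finset.inter_subset_right, aux Y ?_⟩
      simp only [Finset.mem_symmDiff] at hc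
      tauto
  obtain ⟨V, hV⟩ := hE.exists_cube hS
  -- This is the corner of the cube at `V` that agrees with `X` on `insert c T`.
  refine ⟨symmDiff V (symmDiff V X ∩ insert c T), ?_, fun H hH => ?_⟩
  · intro x hx
    have hVm := (Finset.mem_filter.1 (hV (symmDiff V X ∩ insert c T) Finset.inter_subset_right))
    have h₁ := hVm.2 x
    have h₂ : x ∈ symmDiff V (symmDiff V X ∩ insert c T) → x ∈ F.biUnion id :=
      fun h => Finset.mem_biUnion.2 ⟨_, hVm.1, h⟩
    have h₃ : x ∈ F.biUnion id ∪ X := by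
      rw [Finset.mem_union]
      rw [Finset.mem_symmDiff] at hx
      tauto
    have h₄ : x ∉ insert c T := by
      intro h
      simp only [Finset.mem_symmDiff, Finset.mem_inter, h] at hx
      tauto
    rw [Finset.mem_insert, not_or] at h₄
    rw [Finset.mem_erase]
    refine ⟨h₄.1, ?_⟩
    by_contra h₅
    have h₆ := h₁ (Finset.mem_sdiff.2 ⟨h₃, by simp only [Finset.mem_union]; tauto⟩)
    rw [Finset.mem_symmDiff] at hx
    tauto
  · rw [symmDiff_assoc]
    refine (Finset.mem_filter.1 (hV _ ?_)).1
    intro x hx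
    have := @hH x
    simp only [Finset.mem_symmDiff, Finset.mem_inter] at hx
    tauto

/-- The `T`-cubes of an extremal family form an isometric subgraph. -/
lemma IsExtremal.exists_adjacent_cube {F : Finset (Finset α)} (hF : IsExtremal F)
    {X Y T : Finset α} (hT : Disjoint T (symmDiff X Y))
    (hX : ∀ H ⊆ T, symmDiff X H ∈ F) (hY : ∀ H ⊆ T, symmDiff Y H ∈ F) (hne : X ≠ Y) :
    ∃ c ∈ symmDiff X Y, ∀ H ⊆ T, symmDiff (symmDiff X {c}) H ∈ F := by
  induction hn : (symmDiff X Y).card using Nat.strong_induction_on generalizing Y with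
  | _ n ih =>
  subst hn
  obtain ⟨c, hc⟩ : (symmDiff X Y).Nonempty := by
    rw [Finset.nonempty_iff_ne_empty]
    exact fun h => hne (symmDiff_eq_bot.1 h)
  obtain ⟨Z, hZ, hZF⟩ := hF.exists_cube_between hT hX hY hc
  -- Either the larger cube sits at `X` and `c` is the wanted direction, or its corner `Z` replaces
  -- `Y` and is strictly closer to `X`.
  by_cases h : X = Z
  · subst h
    refine ⟨c, hc, fun H hH => ?_⟩
    rw [symmDiff_assoc]
    refine hZF _ fun x hx => ?_
    have := @hH x
    simp only [Finset.mem_symmDiff, Finset.mem_singleton] at hx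
    rw [Finset.mem_insert]
    tauto
  · have hsub := hZ.trans (Finset.erase_subset _ _)
    obtain ⟨d, hd, hdF⟩ := ih _
      ((Finset.card_le_card hZ).trans_lt (Finset.card_erase_lt_of_mem hc))
      (hT.mono_right hsub) (fun H hH => hZF H (hH.trans (Finset.subset_insert _ _))) h rfl
    exact ⟨d, hsub hd, hdF⟩

/-! ### Steps A and B preserve extremality and the dimension bound -/

lemma vcDim_le_iff {F : Finset (Finset α)} {k : ℕ} :
    F.vcDim ≤ k ↔ ∀ S, F.Shatters S → S.card ≤ k := by
  simp [Finset.vcDim, Finset.sup_le_iff]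

lemma IsExtremal.insert_of_shatters {F : Finset (Finset α)} (hF : IsExtremal F)
    (hd : F.vcDim ≤ 2) {N S : Finset α} (hN : N ∉ F) (hS : S.card ≤ 2)
    (h : ∀ T, (insert N F).Shatters T → F.Shatters T ∨ T = S) :
    IsExtremal (insert N F) ∧ (insert N F).vcDim ≤ 2 := by
  constructor
  · have h₁ : (insert N F).shatterer ⊆ insert S F.shatterer := by
      intro T hT
      rw [Finset.mem_shatterer] at hT
      rw [Finset.mem_insert, Finset.mem_shatterer]
      exact (h T hT).symm
    have h₂ := (Finset.card_le_card h₁).trans (Finset.card_insert_le _ _)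
    have h₃ := Finset.card_le_card_shatterer (insert N F)
    have h₄ := Finset.card_insert_of_notMem hN
    unfold IsExtremal at *
    omega
  · rw [vcDim_le_iff] at hd ⊢
    intro T hT
    rcases h T hT with h | rfl
    · exact hd T h
    · exact hS

/-- Only the new set contains `a`, so no shattered set can contain `a` together with another
element; on sets avoiding `a` the new set has the same trace as `W`. -/
lemma IsExtremal.stepA {F F' : Finset (Finset α)} (hF : IsExtremal F)
    (hd : F.vcDim ≤ 2) (h : StepA F F') : IsExtremal F' ∧ F'.vcDim ≤ 2 := by
  obtain ⟨a, ha, W, hW, rfl⟩ := h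
  have ha' : ∀ X ∈ F, a ∉ X := fun X hX h => ha (Finset.mem_biUnion.2 ⟨X, hX, h⟩)
  refine hF.insert_of_shatters hd (S := {a}) (fun h => ha' _ h (by simp)) (by simp) ?_
  intro T hT
  by_cases haT : a ∈ T
  · right
    refine Finset.eq_singleton_iff_unique_mem.2 ⟨haT, fun c hc => ?_⟩
    by_contra hca
    obtain ⟨u, hu, h₁⟩ := hT (t := {a}) (by simpa using haT)
    obtain ⟨v, hv, h₂⟩ := hT (t := {a, c}) (by
      intro x hx
      simp only [Finset.mem_insert, Finset.mem_singleton] at hx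
      rcases hx with rfl | rfl <;> assumption)
    have hau : a ∈ u := (Finset.mem_inter.1 (h₁ ▸ Finset.mem_singleton_self a)).2
    have hav : a ∈ v := (Finset.mem_inter.1 (h₂ ▸ Finset.mem_insert_self a _)).2
    have hcv : c ∈ T ∩ v := h₂ ▸ (by simp)
    rw [(Finset.mem_insert.1 hv).resolve_right fun h => ha' v h hav,
      ← (Finset.mem_insert.1 hu).resolve_right fun h => ha' u h hau, h₁] at hcv
    exact hca (Finset.mem_singleton.1 hcv)
  · left
    intro t ht
    obtain ⟨u, hu, h⟩ := hT ht
    rcases Finset.mem_insert.1 hu with rfl | hu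
    · refine ⟨W, hW, ?_⟩
      rw [← h, Finset.inter_union_distrib_left, Finset.inter_singleton_of_notMem haT,
        Finset.union_empty]
    · exact ⟨u, hu, h⟩

lemma shatters_pair {F : Finset (Finset α)} {a b : α} {W : Finset α} (hW : W ∈ F)
    (ha : symmDiff W {a} ∈ F) (hb : symmDiff W {b} ∈ F) (hab : symmDiff W {a, b} ∈ F) :
    F.Shatters {a, b} := by
  intro t ht
  have key : symmDiff W (symmDiff W t ∩ {a, b}) ∈ F := by
    have : symmDiff W t ∩ {a, b} ∈ ({a, b} : Finset α).powerset :=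
      Finset.mem_powerset.2 Finset.inter_subset_right
    generalize symmDiff W t ∩ {a, b} = K at this
    have hK : K = ∅ ∨ K = {a} ∨ K = {b} ∨ K = {a, b} := by
      rw [Finset.mem_powerset, Finset.subset_iff] at this
      simp only [Finset.mem_insert, Finset.mem_singleton] at this
      by_cases h₁ : a ∈ K <;> by_cases h₂ : b ∈ K
      · right; right; right
        ext x
        have := @this x
        simp only [Finset.mem_insert, Finset.mem_singleton]
        constructor
        · exact this
        · rintro (rfl | rfl) <;> assumption
      · right; left
        exact Finset.eq_singleton_iff_unique_mem.2 ⟨h₁, fun x hx =>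
          (this hx).resolve_right fun h => h₂ (h ▸ hx)⟩
      · right; right; left
        exact Finset.eq_singleton_iff_unique_mem.2 ⟨h₂, fun x hx =>
          (this hx).resolve_left fun h => h₁ (h ▸ hx)⟩
      · left
        refine Finset.eq_empty_of_forall_notMem fun x hx => ?_
        rcases this hx with rfl | rfl <;> contradiction
    rcases hK with rfl | rfl | rfl | rfl
    · rwa [symmDiff_empty]
    · exact ha
    · exact hb
    · exact hab
  refine ⟨_, key, ?_⟩
  ext x
  have := @ht x
  simp only [Finset.mem_symmDiff, Finset.mem_inter] at this ⊢
  tauto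

/-- A newly shattered `T` contains `a` and `b`, since off `a` the new set looks like `P` and off `b`
like `Q`. A third element `c` of `T` is impossible: prescribing at `c` the opposite of the new set's
value forces all traces on `{a, b}` to come from `F`, which would then strongly shatter `{a, b}`. -/
lemma IsExtremal.stepB {F F' : Finset (Finset α)} (hF : IsExtremal F)
    (hd : F.vcDim ≤ 2) (h : StepB F F') : IsExtremal F' ∧ F'.vcDim ≤ 2 := by
  obtain ⟨a, -, b, -, hab, hns, P, hP, W, hW, Q, hQ, hQW, hPW, rfl⟩ := h
  have hQ' : Q = symmDiff W {a} := by
    rw [← hQW, symmDiff_comm Q W, symmDiff_symmDiff_cancel_left]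
  have hP' : P = symmDiff W {b} := by
    rw [← hPW, symmDiff_comm P W, symmDiff_symmDiff_cancel_left]
  subst hQ' hP'
  have hns' : ¬ F.Shatters {a, b} := fun h => hns (hF.stronglyShatters h)
  refine hF.insert_of_shatters hd (S := {a, b})
    (fun h => hns' (shatters_pair hW hQ hP h)) Finset.card_le_two ?_
  intro T hT
  by_contra hcon
  rw [not_or] at hcon
  obtain ⟨hTF, hTne⟩ := hcon
  have haT : a ∈ T := by
    by_contra haT
    apply hTF
    intro t ht
    obtain ⟨u, hu, h⟩ := hT ht
    rcases Finset.mem_insert.1 hu with rfl | hu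
    · refine ⟨_, hP, ?_⟩
      rw [← h]
      ext x
      have : x ∈ T → x ≠ a := fun h h' => haT (h' ▸ h)
      simp only [Finset.mem_symmDiff, Finset.mem_inter, Finset.mem_insert, Finset.mem_singleton]
      tauto
    · exact ⟨u, hu, h⟩
  have hbT : b ∈ T := by
    by_contra hbT
    apply hTF
    intro t ht
    obtain ⟨u, hu, h⟩ := hT ht
    rcases Finset.mem_insert.1 hu with rfl | hu
    · refine ⟨_, hQ, ?_⟩
      rw [← h]
      ext x
      have : x ∈ T → x ≠ b := fun h h' => hbT (h' ▸ h)
      simp only [Finset.mem_symmDiff, Finset.mem_inter, Finset.mem_insert, Finset.mem_singleton]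
      tauto
    · exact ⟨u, hu, h⟩
  have hsub : ({a, b} : Finset α) ⊆ T := by
    intro x hx
    simp only [Finset.mem_insert, Finset.mem_singleton] at hx
    rcases hx with rfl | rfl <;> assumption
  obtain ⟨c, hcT, hc⟩ := Finset.exists_of_ssubset (hsub.ssubset_of_ne (Ne.symm hTne))
  apply hns'
  intro t ht
  have hct : c ∉ t := fun h => hc (ht h)
  obtain ⟨t', ht', hcN, ht't⟩ : ∃ t' ⊆ T, ¬ (c ∈ t' ↔ c ∈ symmDiff W {a, b}) ∧
      {a, b} ∩ t' = t := by
    by_cases hcW : c ∈ symmDiff W {a, b}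
    · exact ⟨t, ht.trans hsub, by tauto, Finset.inter_eq_right.2 ht⟩
    · refine ⟨insert c t, Finset.insert_subset hcT (ht.trans hsub), by simp [hcW], ?_⟩
      rw [Finset.inter_insert_of_notMem hc, Finset.inter_eq_right.2 ht]
  obtain ⟨u, hu, h⟩ := hT ht'
  rcases Finset.mem_insert.1 hu with rfl | hu
  · exact (hcN (by rw [← h]; simp only [Finset.mem_inter, hcT, true_and])).elim
  · refine ⟨u, hu, ?_⟩
    rw [← ht't, ← h, ← Finset.inter_assoc, Finset.inter_eq_left.2 hsub]

lemma IsConstructible.isExtremal {F : Finset (Finset α)} (hF : IsConstructible F) :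
    IsExtremal F ∧ F.vcDim ≤ 2 ∧ ∅ ∈ F := by
  induction hF with
  | init =>
    have h : ∀ S : Finset α, ({∅} : Finset (Finset α)).Shatters S → S = ∅ := fun S hS =>
      Finset.eq_empty_of_forall_notMem fun x hx =>
        notMem_of_shatters_of_forall_notMem (a := x) (by simp) hS hx
    refine ⟨?_, vcDim_le_iff.2 fun S hS => by simp [h S hS], by simp⟩
    refine le_antisymm ?_ (Finset.card_le_card_shatterer _)
    refine Finset.card_le_card fun S hS => ?_
    simp [h S (Finset.mem_shatterer.1 hS)]
  | stepA _ h ih =>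
    obtain ⟨h₁, h₂⟩ := ih.1.stepA ih.2.1 h
    obtain ⟨a, ha, W, hW, rfl⟩ := h
    exact ⟨h₁, h₂, Finset.mem_insert_of_mem ih.2.2⟩
  | stepB _ h ih =>
    obtain ⟨h₁, h₂⟩ := ih.1.stepB ih.2.1 h
    obtain ⟨a, -, b, -, hab, hns, P, hP, W, hW, Q, hQ, hQW, hPW, rfl⟩ := h
    exact ⟨h₁, h₂, Finset.mem_insert_of_mem ih.2.2⟩

/-! ### Building up an extremal family -/

/-- In a family of VC-dimension at most two each pair of directions spans at most one square. -/
lemma square_unique {F : Finset (Finset α)} (hd : F.vcDim ≤ 2) {a b : α} (hab : a ≠ b)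
    {X Y : Finset α} (hX : ∀ H ⊆ {a, b}, symmDiff X H ∈ F)
    (hY : ∀ H ⊆ {a, b}, symmDiff Y H ∈ F) : symmDiff X Y ⊆ {a, b} := by
  intro c hc
  by_contra hcab
  have hcard : ({a, b, c} : Finset α).card = 3 := by
    refine Finset.card_eq_three.2 ⟨a, b, c, hab, ?_, ?_, rfl⟩ <;>
    · rintro rfl
      simp at hcab
  -- Squares on both sides of `c` realize every trace on three elements.
  have : F.Shatters {a, b, c} := by
    intro t ht
    have aux : ∀ V : Finset α, (c ∈ V ↔ c ∈ t) →
        {a, b, c} ∩ symmDiff V (symmDiff V t ∩ {a, b}) = t := by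
      intro V hV
      ext x
      have := @ht x
      by_cases hxc : x = c
      · subst hxc
        simp only [Finset.mem_symmDiff, Finset.mem_inter, Finset.mem_insert,
          Finset.mem_singleton] at hcab ⊢
        tauto
      · simp only [Finset.mem_symmDiff, Finset.mem_inter, Finset.mem_insert,
          Finset.mem_singleton, hxc, or_false] at this ⊢
        tauto
    by_cases h : c ∈ X ↔ c ∈ t
    · exact ⟨_, hX _ Finset.inter_subset_right, aux X h⟩
    · refine ⟨_, hY _ Finset.inter_subset_right, aux Y ?_⟩
      simp only [Finset.mem_symmDiff] at hc
      tauto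
  have := vcDim_le_iff.1 hd _ this
  omega

lemma mem_supp_of_mem_symmDiff {F : Finset (Finset α)} {X Y : Finset α} {a : α} (hX : X ∈ F)
    (hY : Y ∈ F) (ha : a ∈ symmDiff X Y) : a ∈ supp F := by
  rcases Finset.mem_symmDiff.1 ha with h | h
  · exact Finset.mem_biUnion.2 ⟨X, hX, h.1⟩
  · exact Finset.mem_biUnion.2 ⟨Y, hY, h.1⟩

lemma forall_subset_singleton_symmDiff {F : Finset (Finset α)} {X : Finset α} {a : α}
    (hX : X ∈ F) (ha : symmDiff X {a} ∈ F) : ∀ H ⊆ {a}, symmDiff X H ∈ F := by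
  intro H hH
  rcases Finset.subset_singleton_iff.1 hH with rfl | rfl
  · rwa [symmDiff_empty]
  · exact ha

lemma forall_subset_empty_symmDiff {F : Finset (Finset α)} {X : Finset α}
    (hX : X ∈ F) : ∀ H ⊆ ∅, symmDiff X H ∈ F := by
  intro H hH
  rw [Finset.subset_empty.1 hH]
  rwa [symmDiff_empty]

/-- Between two members of an extremal family separated by `b` there is an edge in
direction `b`. -/
lemma IsExtremal.exists_edge_between {F : Finset (Finset α)} (hF : IsExtremal F)
    {X Y : Finset α} {b : α} (hX : X ∈ F) (hY : Y ∈ F) (hb : b ∈ symmDiff X Y) :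
    ∃ V ∈ F, symmDiff V {b} ∈ F ∧ symmDiff X V ⊆ (symmDiff X Y).erase b := by
  obtain ⟨V, h₁, h₂⟩ := hF.exists_cube_between (Finset.disjoint_empty_left _)
    (forall_subset_empty_symmDiff hX) (forall_subset_empty_symmDiff hY) hb
  exact ⟨V, by simpa [symmDiff_empty] using h₂ ∅ (by simp), h₂ {b} (by simp), h₁⟩

/-- A proper nonempty subfamily of an extremal family is left by some edge. -/
lemma IsExtremal.exists_boundary_edge {F G : Finset (Finset α)} (hF : IsExtremal F)
    (hGF : G ⊆ F) {X Y : Finset α} (hX : X ∈ G) (hY : Y ∈ F) (hYG : Y ∉ G) :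
    ∃ W ∈ G, ∃ a, symmDiff W {a} ∈ F ∧ symmDiff W {a} ∉ G := by
  induction hn : (symmDiff Y X).card using Nat.strong_induction_on generalizing Y with
  | _ n ih =>
  subst hn
  have hne : Y ≠ X := fun h => hYG (h ▸ hX)
  obtain ⟨c, hc, h⟩ := hF.exists_adjacent_cube (Finset.disjoint_empty_left _)
    (forall_subset_empty_symmDiff hY) (forall_subset_empty_symmDiff (hGF hX)) hne
  have hYc : symmDiff Y {c} ∈ F := by simpa [symmDiff_empty] using h ∅ (by simp)
  by_cases hG : symmDiff Y {c} ∈ G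
  · exact ⟨_, hG, c, by simpa using hY, by simpa using hYG⟩
  · refine ih _ ?_ hYc hG rfl
    refine Finset.card_lt_card (Finset.ssubset_iff_subset_ne.2 ⟨?_, ?_⟩)
    · intro x
      by_cases hx : x = c
      · subst hx
        exact fun _ => hc
      · simp only [Finset.mem_symmDiff, Finset.mem_singleton, hx]
        tauto
    · intro h
      rw [← h] at hc
      rw [Finset.mem_symmDiff] at hc
      have := Finset.ext_iff.1 h c
      simp only [Finset.mem_symmDiff, Finset.mem_singleton] at hc this
      tauto

/-- If an extremal subfamily `G` of an extremal family `F` of VC-dimension at most two is left by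
an edge whose direction also occurs inside `G`, then a Step B within `F` applies to `G`. -/
lemma exists_stepB {F G : Finset (Finset α)} (hF : IsExtremal F) (hd : F.vcDim ≤ 2)
    (hG : IsExtremal G) (hGF : G ⊆ F) {W U : Finset α} {a : α} (hW : W ∈ G)
    (hWa : symmDiff W {a} ∈ F) (hWa' : symmDiff W {a} ∉ G) (hU : U ∈ G)
    (hUa : symmDiff U {a} ∈ G) (ha : a ∉ symmDiff W U) :
    ∃ N ∈ F, N ∉ G ∧ StepB G (insert N G) := by
  induction hn : (symmDiff W U).card using Nat.strong_induction_on generalizing W U a with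
  | _ n ih =>
  subst hn
  have hne : W ≠ U := fun h => hWa' (h ▸ hUa)
  -- Isometry of the `a`-edges of `F` gives a square of `F` at `W` in directions `a`, `b`, one step
  -- closer to `U`.
  obtain ⟨b, hb, hbF⟩ := hF.exists_adjacent_cube (T := {a})
    (Finset.disjoint_singleton_left.2 ha) (forall_subset_singleton_symmDiff (hGF hW) hWa)
    (forall_subset_singleton_symmDiff (hGF hU) (hGF hUa)) hne
  have hWb : symmDiff W {b} ∈ F := by simpa [symmDiff_empty] using hbF ∅ (by simp)
  have hWba : symmDiff (symmDiff W {b}) {a} ∈ F := hbF {a} (by simp)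
  have hba : a ≠ b := fun h => ha (h ▸ hb)
  have hpair : symmDiff {b} {a} = ({a, b} : Finset α) := by
    ext x
    simp only [Finset.mem_symmDiff, Finset.mem_singleton, Finset.mem_insert]
    constructor
    · tauto
    · rintro (rfl | rfl) <;> simp [hba, hba.symm]
  by_cases hWbG : symmDiff W {b} ∈ G
  · by_cases hWbaG : symmDiff (symmDiff W {b}) {a} ∈ G
    · refine ⟨symmDiff W {a}, hWa, hWa', a, ?_, b, ?_, hba, ?_, W, hW, symmDiff W {b}, hWbG,
        symmDiff (symmDiff W {b}) {a}, hWbaG, ?_, ?_, ?_⟩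
      · exact mem_supp_of_mem_symmDiff hWbG hWbaG (by simp)
      · exact mem_supp_of_mem_symmDiff hW hWbG (by simp)
      -- A square of `G` in directions `a`, `b` would, by uniqueness in `F`, be the square at `W`,
      -- putting the missing corner in `G`.
      · rintro ⟨I, hI, hIG⟩
        have hI' : ∀ H ⊆ {a, b}, symmDiff I H ∈ G := by
          intro H hH
          have hdis : Disjoint I H := hI.mono_right hH
          rw [hdis.symmDiff_eq_sup, sup_comm]
          exact hIG H hH
        have hsq : ∀ H ⊆ {a, b}, symmDiff W H ∈ F := by
          intro H hH
          by_cases hbH : b ∈ H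
          · have : symmDiff W H = symmDiff (symmDiff W {b}) (symmDiff {b} H) := by
              rw [symmDiff_assoc, symmDiff_symmDiff_cancel_left]
            rw [this]
            refine hbF _ fun x hx => ?_
            have := @hH x
            simp only [Finset.mem_symmDiff, Finset.mem_singleton, Finset.mem_insert] at this hx ⊢
            rcases hx with ⟨rfl, h⟩ | h
            · exact (h hbH).elim
            · tauto
          · refine forall_subset_singleton_symmDiff (hGF hW) hWa H fun x hx => ?_
            have := hH hx
            rw [Finset.mem_insert, Finset.mem_singleton] at this
            exact Finset.mem_singleton.2 (this.resolve_right fun h => hbH (h ▸ hx))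
        have hsub := square_unique hd hba hsq fun H hH => hGF (hI' H hH)
        apply hWa'
        have h := hI' (symmDiff I (symmDiff W {a})) (by
          intro x hx
          have := @hsub x
          simp only [Finset.mem_symmDiff, Finset.mem_singleton, Finset.mem_insert] at this hx ⊢
          tauto)
        rwa [symmDiff_symmDiff_cancel_left] at h
      · rw [symmDiff_comm, symmDiff_symmDiff_cancel_left]
      · rw [symmDiff_symmDiff_cancel_left]
      · rw [symmDiff_assoc, ← hpair, symmDiff_symmDiff_cancel_left]
    -- The parallel edge at `symmDiff W {b}` also leaves `G` and is closer to `U`.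
    · refine ih _ ?_ hWbG hWba hWbaG hU hUa ?_ rfl
      · refine Finset.card_lt_card (Finset.ssubset_iff_subset_ne.2 ⟨?_, ?_⟩)
        · intro x
          by_cases hx : x = b
          · subst hx
            exact fun _ => hb
          · simp only [Finset.mem_symmDiff, Finset.mem_singleton, hx]
            tauto
        · intro h
          have := Finset.ext_iff.1 h b
          simp only [Finset.mem_symmDiff, Finset.mem_singleton] at hb this
          tauto
      · simp only [Finset.mem_symmDiff, Finset.mem_singleton] at ha ⊢
        tauto
  -- Here the direction changes: the `b`-edge at `W` leaves `G`, and since `b` separates `W` from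
  -- `U`, extremality of `G` supplies a `b`-edge of `G` closer to `W` than `U` is.
  · obtain ⟨V, hV, hVb, hsub⟩ := hG.exists_edge_between hW hU hb
    exact ih _ ((Finset.card_le_card hsub).trans_lt (Finset.card_erase_lt_of_mem hb))
      hW hWb hWbG hV hVb (fun h => Finset.notMem_erase _ _ (hsub h)) rfl

lemma IsExtremal.isConstructible {F : Finset (Finset α)} (hF : IsExtremal F) (hd : F.vcDim ≤ 2)
    (h0 : ∅ ∈ F) : IsConstructible F := by
  classical
  obtain ⟨G, hG, hmax⟩ := (F.powerset.filter IsConstructible).exists_max_image Finset.card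
    ⟨{∅}, by simp [h0, IsConstructible.init]⟩
  rw [Finset.mem_filter, Finset.mem_powerset] at hG
  obtain ⟨hGF, hGc⟩ := hG
  have hstep : ∀ N ∈ F, N ∉ G → ¬ IsConstructible (insert N G) := by
    intro N hN hNG h
    have := hmax _ (Finset.mem_filter.2
      ⟨Finset.mem_powerset.2 (Finset.insert_subset hN hGF), h⟩)
    rw [Finset.card_insert_of_notMem hNG] at this
    omega
  obtain ⟨hGe, -, hG0⟩ := hGc.isExtremal
  by_contra hcon
  have hne : ¬ F ⊆ G := fun h => hcon (hGF.antisymm h ▸ hGc)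
  obtain ⟨Y, hY, hYG⟩ := Finset.not_subset.1 hne
  obtain ⟨W, hW, a, hWa, hWa'⟩ := hF.exists_boundary_edge hGF hG0 hY hYG
  by_cases ha : a ∈ supp G
  · obtain ⟨X, hX, haX⟩ := Finset.mem_biUnion.1 ha
    -- Some member of `G` lies on the other side of `a` from `W`: `∅` if `a ∈ W`, and otherwise a
    -- member witnessing `a ∈ supp G`. An `a`-edge of `G` between the two has an end on the side of
    -- `W`.
    obtain ⟨U, hU, hUa, haU⟩ : ∃ U ∈ G, symmDiff U {a} ∈ G ∧ a ∉ symmDiff W U := by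
      by_cases haW : a ∈ W
      · obtain ⟨V, hV, hVa, hsub⟩ := hGe.exists_edge_between (b := a) hW hG0 (by rwa [symmDiff_empty])
        exact ⟨V, hV, hVa, fun h => Finset.notMem_erase _ _ (hsub h)⟩
      · obtain ⟨V, hV, hVa, hsub⟩ := hGe.exists_edge_between (b := a) hW hX
          (Finset.mem_symmDiff.2 (Or.inr ⟨haX, haW⟩))
        exact ⟨V, hV, hVa, fun h => Finset.notMem_erase _ _ (hsub h)⟩
    obtain ⟨N, hN, hNG, h⟩ := exists_stepB hF hd hGe hGF hW hWa hWa' hU hUa haU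
    exact hstep N hN hNG (hGc.stepB h)
  · refine hstep _ hWa hWa' (hGc.stepA ⟨a, ha, W, hW, ?_⟩)
    have haW : a ∉ W := fun h => ha (Finset.mem_biUnion.2 ⟨W, hW, h⟩)
    rw [(Finset.disjoint_singleton_right.2 haW).symmDiff_eq_sup, Finset.sup_eq_union]

end ShatteringExtremal

theorem theorem1 (n : ℕ) (F : Finset (Finset (Fin n))) :
    (ShatteringExtremal.IsExtremal F ∧ F.vcDim ≤ 2 ∧ ∅ ∈ F) ↔
      ShatteringExtremal.IsConstructible F :=
  ⟨fun h => h.1.isConstructible h.2.1 h.2.2, fun h => h.isExtremal⟩
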